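/- Let $n=1$ or $n=2$ and let $V:\mathbb R^n\to\mathbb R$ be a locally integrable potential with $V\ge 0$ almost everywhere, $V$ not almost everywhere zero, and $\int_{\mathbb R^n}V(x)^{n/2}\,dx<\infty$. Let $H_0=-\Delta$, and let $H=-\Delta+V$ be the nonnegative self-adjoint operator on $L^2(\mathbb R^n)$ associated with the closed quadratic form $u\mapsto\int_{\mathbb R^n}\bigl(|\nabla u|^2+V|u|^2\bigr)\,dx$ on $\{u\in H^1(\mathbb R^n):\sqrt V\,u\in L^2(\mathbb R^n)\}$. Then the equivalence of homogeneous Sobolev norms $$\|H^{s/2}f\|_{L^2(\mathbb R^n)}\sim\|H_0^{s/2}f\|_{L^2(\mathbb R^n)}$$ fails at $s=n/2$, even on test functions: there are no constants $c,C>0$ such that $$c\,\|H_0^{n/4}f\|_{L^2(\mathbb R^n)}\le\|H^{n/4}f\|_{L^2(\mathbb R^n)}\le C\,\|H_0^{n/4}f\|_{L^2(\mathbb R^n)}$$ for all $f\in C_c^\infty(\mathbb R^n)$ in the domain of $H^{n/4}$. -/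

import Mathlib

open MeasureTheory
open scoped ContDiff SchwartzMap FourierTransform

noncomputable section

namespace HomSobolev

/-! ### Fractional powers of a nonnegative self-adjoint operator -/

section FractionalPower

variable {E : Type*} [NormedAddCommGroup E] [InnerProductSpace ℂ E] [CompleteSpace E]

/-- The bounded operator `R` is the inverse of `1 + A`: one has `R x = y` if and only if
`y ∈ D(A)` and `y + A y = x`. -/
def IsResolvent (A : E →ₗ.[ℂ] E) (R : E →L[ℂ] E) : Prop :=
  ∀ x y : E, R x = y ↔ (y, x - y) ∈ A.graph

open Classical in
/-- The resolvent `(1 + A)⁻¹`. It is everywhere defined and bounded, with `0 ≤ (1 + A)⁻¹ ≤ 1`, when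
`A` is nonnegative and self-adjoint. -/
def resolvent (A : E →ₗ.[ℂ] E) : E →L[ℂ] E :=
  if h : ∃ R : E →L[ℂ] E, IsResolvent A R then h.choose else 0

/-- The fractional power `A ^ α`, `α > 0`, of a nonnegative self-adjoint operator `A`, through the
functional calculus of the bounded operator `R = (1 + A)⁻¹`: as `A = (1 - R) R⁻¹`,
one has `A ^ α = (1 - R) ^ α (R ^ α)⁻¹`, with domain the range of `R ^ α`. -/
def fracPow (A : E →ₗ.[ℂ] E) (α : ℝ) : E →ₗ.[ℂ] E :=
  (((1 - resolvent A) ^ α : E →L[ℂ] E) : E →ₗ[ℂ] E).compPMap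
    ((((resolvent A ^ α : E →L[ℂ] E) : E →ₗ[ℂ] E).toPMap ⊤).inverse)

end FractionalPower

/-! ### The Hamiltonian -/

/-- The Euclidean space `ℝⁿ`. -/
abbrev Space (n : ℕ) : Type := EuclideanSpace ℝ (Fin n)

/-- The complex Hilbert space `L²(ℝⁿ)`. -/
abbrev L2 (n : ℕ) : Type := Lp ℂ 2 (volume : Measure (Space n))

/-- `g` is the weak partial derivative `∂u/∂xᵢ`. -/
def IsWeakDeriv {n : ℕ} (i : Fin n) (u g : L2 n) : Prop :=
  ∀ φ : Space n → ℝ, ContDiff ℝ ∞ φ → HasCompactSupport φ →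
    ∫ x, fderiv ℝ φ x (EuclideanSpace.single i 1) • u x = -∫ x, φ x • g x

lemma integrable_smul_test {n : ℕ} (u : L2 n) {ψ : Space n → ℝ} (hψ : Continuous ψ)
    (hc : HasCompactSupport ψ) : Integrable (fun x => ψ x • u x) := by
  have h : MemLp ψ 2 (volume : Measure (Space n)) := hψ.memLp_of_hasCompactSupport hc
  exact memLp_one_iff_integrable.1 ((Lp.memLp u).smul h)

lemma integrable_smul_fderiv_test {n : ℕ} (u : L2 n) {φ : Space n → ℝ} (hφ : ContDiff ℝ ∞ φ)
    (hc : HasCompactSupport φ) (e : Space n) :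
    Integrable (fun x => fderiv ℝ φ x e • u x) :=
  integrable_smul_test u ((hφ.continuous_fderiv (by simp)).clm_apply continuous_const)
    (hc.fderiv_apply (𝕜 := ℝ) e)

lemma IsWeakDeriv.add {n : ℕ} {i : Fin n} {u g u' g' : L2 n} (h : IsWeakDeriv i u g)
    (h' : IsWeakDeriv i u' g') : IsWeakDeriv i (u + u') (g + g') := by
  intro φ hφ hc
  have e1 : ∫ x, fderiv ℝ φ x (EuclideanSpace.single i 1) • (u + u') x =
      ∫ x, (fderiv ℝ φ x (EuclideanSpace.single i 1) • u x +
        fderiv ℝ φ x (EuclideanSpace.single i 1) • u' x) := by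
    refine integral_congr_ae ?_
    filter_upwards [Lp.coeFn_add u u'] with x hx
    rw [hx, Pi.add_apply, smul_add]
  have e2 : ∫ x, φ x • (g + g') x = ∫ x, (φ x • g x + φ x • g' x) := by
    refine integral_congr_ae ?_
    filter_upwards [Lp.coeFn_add g g'] with x hx
    rw [hx, Pi.add_apply, smul_add]
  rw [e1, e2, integral_add (integrable_smul_fderiv_test u hφ hc _)
    (integrable_smul_fderiv_test u' hφ hc _), integral_add
    (integrable_smul_test g hφ.continuous hc) (integrable_smul_test g' hφ.continuous hc),
    h φ hφ hc, h' φ hφ hc, neg_add]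

lemma IsWeakDeriv.smul {n : ℕ} {i : Fin n} {u g : L2 n} (c : ℂ) (h : IsWeakDeriv i u g) :
    IsWeakDeriv i (c • u) (c • g) := by
  intro φ hφ hc
  have e1 : ∫ x, fderiv ℝ φ x (EuclideanSpace.single i 1) • (c • u) x =
      ∫ x, c • (fderiv ℝ φ x (EuclideanSpace.single i 1) • u x) := by
    refine integral_congr_ae ?_
    filter_upwards [Lp.coeFn_smul c u] with x hx
    rw [hx, Pi.smul_apply, smul_comm]
  have e2 : ∫ x, φ x • (c • g) x = ∫ x, c • (φ x • g x) := by
    refine integral_congr_ae ?_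
    filter_upwards [Lp.coeFn_smul c g] with x hx
    rw [hx, Pi.smul_apply, smul_comm]
  rw [e1, e2, integral_smul, integral_smul, h φ hφ hc, smul_neg]

lemma IsWeakDeriv.zero {n : ℕ} (i : Fin n) : IsWeakDeriv i (0 : L2 n) 0 := by
  intro φ hφ hc
  have e (ψ : Space n → ℝ) : ∫ x, ψ x • (0 : L2 n) x = 0 := by
    rw [← integral_zero (Space n) ℂ]
    refine integral_congr_ae ?_
    filter_upwards [Lp.coeFn_zero ℂ 2 (volume : Measure (Space n))] with x hx
    rw [hx, Pi.zero_apply, smul_zero]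
  rw [e, e, neg_zero]

/-- The form domain of `-Δ + V`, `V ≥ 0`, given as the set of all `(u, (∇u, √V u))` such that
`u ∈ L²` has a weak gradient `∇u ∈ L²` and `√V u ∈ L²`. -/
def formGraph {n : ℕ} (V : Space n → ℝ) : Submodule ℂ (L2 n × ((Fin n → L2 n) × L2 n)) where
  carrier := {p | (∀ i, IsWeakDeriv i p.1 (p.2.1 i)) ∧
    p.2.2 =ᵐ[volume] fun x => (Real.sqrt (V x) : ℂ) * p.1 x}
  add_mem' := by
    rintro p q ⟨h, hV⟩ ⟨h', hV'⟩
    refine ⟨fun i => (h i).add (h' i), ?_⟩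
    filter_upwards [hV, hV', Lp.coeFn_add p.1 q.1, Lp.coeFn_add p.2.2 q.2.2] with x h1 h2 h3 h4
    simp only [Prod.snd_add, Prod.fst_add, h3, h4, Pi.add_apply, h1, h2, mul_add]
  zero_mem' := by
    refine ⟨fun i => IsWeakDeriv.zero i, ?_⟩
    filter_upwards [Lp.coeFn_zero ℂ 2 (volume : Measure (Space n))] with x hx
    simp
  smul_mem' := by
    rintro c p ⟨h, hV⟩
    refine ⟨fun i => (h i).smul c, ?_⟩
    filter_upwards [hV, Lp.coeFn_smul c p.1, Lp.coeFn_smul c p.2.2] with x h1 h2 h3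
    simp only [Prod.smul_snd, Prod.smul_fst, h2, h3, Pi.smul_apply, h1, smul_eq_mul]
    ring

/-- For `k = (∇u, √V u)` and `l = (∇v, √V v)` this is
`∫ ∇u · conj ∇v + ∫ V u conj v` (the inner product is linear in its second argument). -/
def formInner {n : ℕ} (l k : (Fin n → L2 n) × L2 n) : ℂ :=
  ∑ i, inner ℂ (l.1 i) (k.1 i) + inner ℂ l.2 k.2

/-- The graph of the operator of the form: the pairs `(u, w)` such that `u` is in the form domain
and `∫ ∇u · conj ∇v + ∫ V u conj v = ∫ w conj v` for all `v` in the form domain. -/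
def hamiltonianGraph {n : ℕ} (V : Space n → ℝ) : Submodule ℂ (L2 n × L2 n) where
  carrier := {p | ∃ k, (p.1, k) ∈ formGraph V ∧
    ∀ v l, (v, l) ∈ formGraph V → formInner l k = inner ℂ v p.2}
  add_mem' := by
    rintro p q ⟨k, hk, h⟩ ⟨k', hk', h'⟩
    refine ⟨k + k', (formGraph V).add_mem hk hk', fun v l hl => ?_⟩
    rw [Prod.snd_add, inner_add_right, ← h v l hl, ← h' v l hl]
    simp only [formInner, Prod.fst_add, Prod.snd_add, Pi.add_apply, inner_add_right,
      Finset.sum_add_distrib]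
    ring
  zero_mem' := ⟨0, (formGraph V).zero_mem, fun v l _ => by simp [formInner]⟩
  smul_mem' := by
    rintro c p ⟨k, hk, h⟩
    refine ⟨c • k, (formGraph V).smul_mem c hk, fun v l hl => ?_⟩
    rw [Prod.smul_snd, inner_smul_right, ← h v l hl]
    simp only [formInner, Prod.smul_fst, Prod.smul_snd, Pi.smul_apply, inner_smul_right,
      Finset.mul_sum, mul_add]

/-- The Hamiltonian `H = -Δ + V` on `L²(ℝⁿ)` for `V ≥ 0` locally integrable: the self-adjoint
operator associated with the closed form `∫ |∇u|² + V |u|²`. -/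
def hamiltonian {n : ℕ} (V : Space n → ℝ) : L2 n →ₗ.[ℂ] L2 n :=
  (hamiltonianGraph V).toLinearPMap

/-! ### The homogeneous Sobolev norms -/

/-- `‖H₀ ^ (s/2) f‖_{L²}` for `H₀ = -Δ`, where `(-Δ) ^ (s/2)` is the Fourier multiplier with symbol
`|2πξ| ^ s` (for the normalisation `𝓕 f ξ = ∫ f x exp (-2πi x·ξ) dx`). -/
def freeNorm {n : ℕ} (s : ℝ) (f : 𝓢(Space n, ℂ)) : ℝ :=
  Real.sqrt (∫ ξ : Space n, ((2 * Real.pi * ‖ξ‖) ^ s * ‖𝓕 (f : Space n → ℂ) ξ‖) ^ 2)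

/-- The equivalence of `‖H ^ (s/2) f‖_{L²}` and `‖H₀ ^ (s/2) f‖_{L²}`, asked for only on the test
functions `f ∈ C_c^∞(ℝⁿ)` in the domain of `H ^ (s/2)`. -/
def HomNormEquiv {n : ℕ} (V : Space n → ℝ) (s : ℝ) : Prop :=
  ∃ c C : ℝ, 0 < c ∧ 0 < C ∧ ∀ f : 𝓢(Space n, ℂ), HasCompactSupport f →
    ∀ hf : f.toLp 2 volume ∈ (fracPow (hamiltonian V) (s / 2)).domain,
      c * freeNorm s f ≤ ‖fracPow (hamiltonian V) (s / 2) ⟨f.toLp 2 volume, hf⟩‖ ∧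
        ‖fracPow (hamiltonian V) (s / 2) ⟨f.toLp 2 volume, hf⟩‖ ≤ C * freeNorm s f

end HomSobolev

end

noncomputable section

namespace HomSobolev

/-! ### Fractional powers and operator inequalities in an abstract Hilbert space -/

section Abstract

variable {E : Type*} [NormedAddCommGroup E] [InnerProductSpace ℂ E]

/-! Already the upper inequality fails. As forms, `H ≥ V`, and for `p = n/2 ≤ 1` the Löwner–Heinz
inequality turns this into `H ^ p ≥ V ^ p`. The upper inequality would then give `∫ V ^ (n/2) |f|² ≤
C² ‖H₀ ^ (n/4) f‖²` for every test function `f`. This is impossible at the critical exponent: there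
are test functions `f_N → 1` pointwise whose free norms tend to `0`, so Fatou's lemma gives `∫ V ^
(n/2) = 0`, that is, `V = 0` almost everywhere.

To avoid unbounded operators, the comparison is made on resolvents: `R = (1 + H)⁻¹ ≤ M = (1 + V)⁻¹`
(`formResolvent_le_mul`). The bounded operator `(1 - M) / (M + ε)` approximates `V`, and
Löwner–Heinz is applied to it and to `(1 - R) / (R + ε)` (`re_inner_rpow_le`). Writing `R = J J†`,
with `J` the inclusion of the form domain, puts test functions in the domain of the fractional power
(`mem_range_sqrt_of_eq_mul_adjoint`); together these give `integral_truncation_le`.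

The functions `f_N` are averages of `N` dyadic dilates of a bump. The critical norm is dilation
invariant and the dilates are almost orthogonal, so its square is `O(1/N)`
(`exists_freeNorm_averagedBump_le`). -/

lemma IsResolvent.resolvent_eq {A : E →ₗ.[ℂ] E} {R : E →L[ℂ] E} (hR : IsResolvent A R) :
    resolvent A = R := by
  have h : ∃ R : E →L[ℂ] E, IsResolvent A R := ⟨R, hR⟩
  have h' : IsResolvent A (resolvent A) := by
    rw [resolvent, dif_pos h]
    exact h.choose_spec
  ext x
  exact (h' x _).2 ((hR x _).1 rfl)

lemma IsResolvent.injective {A : E →ₗ.[ℂ] E} {R : E →L[ℂ] E} (hR : IsResolvent A R) {x : E}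
    (hx : R x = 0) : x = 0 := by
  have := (hR x 0).1 hx
  rw [sub_zero] at this
  exact A.graph_fst_eq_zero_snd this rfl

variable [CompleteSpace E]

/-- With positive exponents the law needs no invertibility of the base, which matters because a
resolvent is in general only injective. -/
lemma rpow_add_of_pos {R : E →L[ℂ] E} {x y : ℝ} (hx : 0 < x) (hy : 0 < y) :
    R ^ (x + y) = R ^ x * R ^ y := by
  lift x to NNReal using hx.le
  lift y to NNReal using hy.le
  have hx' : 0 < x := by exact_mod_cast hx
  have hy' : 0 < y := by exact_mod_cast hy
  rw [← NNReal.coe_add, ← CFC.nnrpow_eq_rpow hx', ← CFC.nnrpow_eq_rpow hy',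
    ← CFC.nnrpow_eq_rpow (add_pos hx' hy'), CFC.nnrpow_add hx' hy']

lemma rpow_one_half_eq {S W : E →L[ℂ] E} (h : S * S = W) (hS : 0 ≤ S) : W ^ (1 / 2 : ℝ) = S := by
  rw [← CFC.sqrt_eq_rpow, CFC.sqrt_unique h hS]

/-- Since `R = R ^ (1 - α) * R ^ α`, the kernel of `R ^ α` lies in that of `R`. -/
lemma rpow_injective {R : E →L[ℂ] E} (h0 : 0 ≤ R) (hR : ∀ x, R x = 0 → x = 0) {α : ℝ}
    (hα : 0 < α) (hα' : α < 1) {x : E} (hx : (R ^ α) x = 0) : x = 0 := by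
  apply hR
  have h := rpow_add_of_pos (R := R) (sub_pos.2 hα') hα
  rw [sub_add_cancel, CFC.rpow_one R] at h
  rw [h]
  change (R ^ (1 - α)) ((R ^ α) x) = 0
  rw [hx, map_zero]

lemma fracPow_apply {A : E →ₗ.[ℂ] E} {R : E →L[ℂ] E} (hR : IsResolvent A R) (h0 : 0 ≤ R) {α : ℝ}
    (hα : 0 < α) (hα' : α < 1) (g : E) :
    ∃ h : (R ^ α) g ∈ (fracPow A α).domain, fracPow A α ⟨(R ^ α) g, h⟩ = ((1 - R) ^ α) g := by
  have hker : LinearMap.ker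
      ((((R ^ α : E →L[ℂ] E) : E →ₗ[ℂ] E).toPMap ⊤).toFun) = ⊥ := by
    rw [LinearMap.ker_eq_bot']
    rintro ⟨x, hx⟩ h
    ext
    exact rpow_injective h0 (fun _ => hR.injective) hα hα' h
  unfold fracPow
  rw [hR.resolvent_eq]
  have hd : (R ^ α) g ∈ ((((R ^ α : E →L[ℂ] E) : E →ₗ[ℂ] E).toPMap ⊤).inverse).domain := by
    rw [LinearPMap.inverse_domain]
    exact ⟨⟨g, trivial⟩, rfl⟩
  refine ⟨hd, ?_⟩
  change ((1 - R) ^ α) (((((R ^ α : E →L[ℂ] E) : E →ₗ[ℂ] E).toPMap ⊤).inverse) ⟨_, hd⟩) = _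
  rw [LinearPMap.inverse_apply_eq hker (x := ⟨g, trivial⟩) rfl]

/-- Since `(1 - r) / (r + ε) = (1 + ε) / (r + ε) - 1` and inversion is operator antitone, `R ≤ M`
reverses. The inverse `Q` of `M + ε` is a parameter, so an explicit multiplication operator can be
inserted for it. -/
lemma cfc_quotient_ge {R M Q : E →L[ℂ] E} (h0 : 0 ≤ R) (hRM : R ≤ M)
    {ε : ℝ} (hε : 0 < ε) (hQ : Q * (M + algebraMap ℝ _ ε) = 1)
    (hQ' : (M + algebraMap ℝ _ ε) * Q = 1) :
    (1 + ε) • Q - 1 ≤ cfc (fun r : ℝ => (1 - r) / (r + ε)) R := by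
  have hsa : IsSelfAdjoint R := h0.isSelfAdjoint
  have hspec : ∀ r ∈ spectrum ℝ R, 0 ≤ r := fun r hr => spectrum_nonneg_of_nonneg h0 hr
  have hne : ∀ r ∈ spectrum ℝ R, r + ε ≠ 0 := fun r hr => by
    have := hspec r hr
    positivity
  have hc : ContinuousOn (fun r : ℝ => (r + ε)⁻¹) (spectrum ℝ R) :=
    ContinuousOn.inv₀ (by fun_prop) hne
  set P := cfc (fun r : ℝ => (r + ε)⁻¹) R with hP
  have hRε : cfc (fun r : ℝ => r + ε) R = R + algebraMap ℝ _ ε := by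
    rw [cfc_add_const ε (fun r => r) R, cfc_id' ℝ R]
  have h1 : P * (R + algebraMap ℝ _ ε) = 1 := by
    rw [← hRε, hP, ← cfc_mul _ _ R hc (by fun_prop), ← cfc_one ℝ R]
    exact cfc_congr fun r hr => inv_mul_cancel₀ (hne r hr)
  have h2 : (R + algebraMap ℝ _ ε) * P = 1 := by
    rw [← hRε, hP, ← cfc_mul _ _ R (by fun_prop) hc, ← cfc_one ℝ R]
    exact cfc_congr fun r hr => mul_inv_cancel₀ (hne r hr)
  have hPQ : Q ≤ P := by
    have := CStarAlgebra.inv_le_inv (a := (⟨R + algebraMap ℝ _ ε, P, h2, h1⟩ : (E →L[ℂ] E)ˣ))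
      (b := ⟨M + algebraMap ℝ _ ε, Q, hQ', hQ⟩)
      (by
        change 0 ≤ R + algebraMap ℝ _ ε
        rw [← hRε]
        exact cfc_nonneg fun r hr => by have := hspec r hr; positivity)
      (add_le_add_left hRM _)
    exact this
  have h3 : cfc (fun r : ℝ => (1 - r) / (r + ε)) R = (1 + ε) • P - 1 := by
    rw [hP, ← cfc_smul _ _ R hc, ← cfc_one ℝ R, ← cfc_sub _ _ R (by fun_prop) (by fun_prop)]
    refine cfc_congr fun r hr => ?_
    have := hne r hr
    simp only [smul_eq_mul, Pi.one_apply]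
    field_simp
    ring
  rw [h3]
  exact sub_le_sub_right (smul_le_smul_of_nonneg_left hPQ (by positivity)) _

/-- Every factor is a function of `R`, so this reduces to `r * (1 - r) / (r + ε) ≤ 1 - r` on the
spectrum, which lies in `[0, 1]`. -/
lemma rpow_mul_cfc_quotient_mul_rpow_le {R : E →L[ℂ] E} (h0 : 0 ≤ R) (h1 : R ≤ 1)
    {ε p : ℝ} (hε : 0 < ε) (hp : 0 < p) :
    R ^ (p / 2) * (cfc (fun r : ℝ => (1 - r) / (r + ε)) R) ^ p * R ^ (p / 2) ≤ (1 - R) ^ p := by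
  have hsa : IsSelfAdjoint R := h0.isSelfAdjoint
  have hspec : ∀ r ∈ spectrum ℝ R, 0 ≤ r := fun r hr => spectrum_nonneg_of_nonneg h0 hr
  have hspec1 : ∀ r ∈ spectrum ℝ R, r ≤ 1 := (le_algebraMap_iff_spectrum_le (r := (1:ℝ))).1
    (by simpa using h1)
  have hne : ∀ r ∈ spectrum ℝ R, r + ε ≠ 0 := fun r hr => by
    have := hspec r hr
    positivity
  have hc : ContinuousOn (fun r : ℝ => (1 - r) / (r + ε)) (spectrum ℝ R) :=
    ContinuousOn.div (by fun_prop) (by fun_prop) hne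
  have hnn : ∀ r ∈ spectrum ℝ R, 0 ≤ (1 - r) / (r + ε) := fun r hr =>
    div_nonneg (sub_nonneg.2 (hspec1 r hr)) (add_nonneg (hspec r hr) hε.le)
  have hcp : ContinuousOn (fun r : ℝ => ((1 - r) / (r + ε)) ^ p) (spectrum ℝ R) :=
    hc.rpow_const fun _ _ => Or.inr hp.le
  have hrp : ContinuousOn (fun r : ℝ => r ^ (p / 2)) (spectrum ℝ R) :=
    continuousOn_id.rpow_const fun _ _ => Or.inr (by positivity)
  have h1p : ContinuousOn (fun r : ℝ => (1 - r) ^ p) (spectrum ℝ R) :=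
    ContinuousOn.rpow_const (by fun_prop) fun _ _ => Or.inr hp.le
  have e1 : (1 - R) ^ p = cfc (fun r : ℝ => (1 - r) ^ p) R := by
    have h : 1 - R = cfc (fun r : ℝ => 1 - r) R := by
      rw [cfc_sub _ _ R (by fun_prop) (by fun_prop), cfc_const_one ℝ R, cfc_id' ℝ R]
    have hn : 0 ≤ cfc (fun r : ℝ => 1 - r) R := h ▸ sub_nonneg.2 h1
    rw [h, CFC.rpow_eq_cfc_real hn, ← cfc_comp' (fun r : ℝ => r ^ p) (fun r : ℝ => 1 - r) R
      (continuousOn_id.rpow_const fun _ _ => Or.inr hp.le) (by fun_prop)]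
  have e2 : (cfc (fun r : ℝ => (1 - r) / (r + ε)) R) ^ p =
      cfc (fun r : ℝ => ((1 - r) / (r + ε)) ^ p) R := by
    rw [CFC.rpow_eq_cfc_real (cfc_nonneg hnn), ← cfc_comp' (fun r : ℝ => r ^ p) _ R
      (continuousOn_id.rpow_const fun _ _ => Or.inr hp.le) hc]
  rw [e1, e2, CFC.rpow_eq_cfc_real h0, ← cfc_mul _ _ R hrp hcp, 
    ← cfc_mul (fun r : ℝ => r ^ (p / 2) * ((1 - r) / (r + ε)) ^ p) _ R (hrp.mul hcp) hrp]
  refine cfc_mono (fun r hr => ?_) ((hrp.mul hcp).mul hrp) h1p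
  have hr0 := hspec r hr
  have hr1 := sub_nonneg.2 (hspec1 r hr)
  calc r ^ (p / 2) * ((1 - r) / (r + ε)) ^ p * r ^ (p / 2)
      = (r ^ (p / 2) * r ^ (p / 2)) * ((1 - r) / (r + ε)) ^ p := by ring
    _ = r ^ p * ((1 - r) / (r + ε)) ^ p := by
      rw [← Real.rpow_add_of_nonneg hr0 (by positivity) (by positivity), add_halves]
    _ = (r * ((1 - r) / (r + ε))) ^ p := (Real.mul_rpow hr0 (hnn r hr)).symm
    _ ≤ (1 - r) ^ p := by
      refine Real.rpow_le_rpow (mul_nonneg hr0 (hnn r hr)) ?_ hp.le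
      rw [mul_div_assoc', div_le_iff₀ (by positivity)]
      nlinarith [mul_nonneg hr1 hε.le]

/-- A Heinz type inequality: if `R = (1 + A)⁻¹ ≤ M` and `W = (1 - M) / (M + ε)` then
`⟨A ^ p f, f⟩ ≥ ⟨W ^ p f, f⟩` for `f = R ^ (p / 2) g`. -/
lemma re_inner_rpow_le {R M Q : E →L[ℂ] E} (h0 : 0 ≤ R) (h1 : R ≤ 1) (hRM : R ≤ M)
    {ε p : ℝ} (hε : 0 < ε) (hp : 0 < p) (hp1 : p ≤ 1) (hQ : Q * (M + algebraMap ℝ _ ε) = 1)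
    (hQ' : (M + algebraMap ℝ _ ε) * Q = 1) (g : E) :
    (inner ℂ ((R ^ (p / 2)) g) ((((1 + ε) • Q - 1) ^ p) ((R ^ (p / 2)) g))).re ≤
      ‖((1 - R) ^ (p / 2)) g‖ ^ 2 := by
  -- Löwner–Heinz: `t ↦ t ^ p` is operator monotone only for `p ≤ 1`, which for `p = n/2` means `n ≤
  -- 2`.
  have hle := CFC.rpow_le_rpow ⟨hp.le, hp1⟩ (cfc_quotient_ge h0 hRM hε hQ hQ')
  have hsa : IsSelfAdjoint (R ^ (p / 2)) := CFC.rpow_nonneg.isSelfAdjoint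
  have hsa' : IsSelfAdjoint ((1 - R) ^ (p / 2)) := CFC.rpow_nonneg.isSelfAdjoint
  have hle2 := (hsa.conjugate_le_conjugate hle).trans
    (rpow_mul_cfc_quotient_mul_rpow_le h0 h1 hε hp)
  rw [← add_halves p, rpow_add_of_pos (R := 1 - R) (half_pos hp) (half_pos hp), add_halves] at hle2
  have h3 := (ContinuousLinearMap.le_def _ _).1 hle2
  have h4 := h3.re_inner_nonneg_right g
  have e1 : ∀ T : E →L[ℂ] E, IsSelfAdjoint T → ∀ x y, inner ℂ (T x) y = inner ℂ x (T y) := by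
    intro T hT x y
    rw [← ContinuousLinearMap.adjoint_inner_right, hT.adjoint_eq]
  simp only [sub_apply, inner_sub_right, map_sub, sub_nonneg] at h4
  rw [e1 _ hsa]
  refine h4.trans (le_of_eq ?_)
  change RCLike.re (inner ℂ g (((1 - R) ^ (p / 2)) (((1 - R) ^ (p / 2)) g))) = _
  rw [← e1 _ hsa', inner_self_eq_norm_sq]

/-- If `R = J J†` then the range of `J` lies in the range of the square root of `R`. -/
lemma mem_range_sqrt_of_eq_mul_adjoint {K : Type*} [NormedAddCommGroup K] [InnerProductSpace ℂ K]
    [CompleteSpace K] {R : E →L[ℂ] E} (h0 : 0 ≤ R) (hR : ∀ x, R x = 0 → x = 0) (J : K →L[ℂ] E)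
    (hJ : R = J.comp (ContinuousLinearMap.adjoint J)) (k : K) :
    ∃ g, (R ^ (1 / 2 : ℝ)) g = J k := by
  set S := R ^ (1 / 2 : ℝ) with hS
  have hsa : IsSelfAdjoint S := CFC.rpow_nonneg.isSelfAdjoint
  have hSS : R = S * S := by
    rw [hS, ← rpow_add_of_pos (by norm_num) (by norm_num)]
    norm_num
    rw [CFC.rpow_one R]
  have e1 : ∀ x y, inner ℂ (S x) y = inner ℂ x (S y) := by
    intro x y
    rw [← ContinuousLinearMap.adjoint_inner_right, hsa.adjoint_eq]
  have hinj : Function.Injective (S : E →ₗ[ℂ] E) := by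
    rw [injective_iff_map_eq_zero]
    intro x hx
    exact rpow_injective h0 hR (by norm_num) (by norm_num) hx
  -- Both squared norms equal `⟨x, R x⟩`.
  have hnorm : ∀ x, ‖ContinuousLinearMap.adjoint J x‖ = ‖S x‖ := by
    intro x
    rw [← sq_eq_sq₀ (norm_nonneg _) (norm_nonneg _), ← inner_self_eq_norm_sq (𝕜 := ℂ),
      ← inner_self_eq_norm_sq (𝕜 := ℂ), ContinuousLinearMap.adjoint_inner_left, e1]
    congr 1
    change inner ℂ x (J (ContinuousLinearMap.adjoint J x)) = inner ℂ x ((S * S) x)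
    rw [← hSS, hJ]
    rfl
  let e := LinearEquiv.ofInjective (S : E →ₗ[ℂ] E) hinj
  -- The functional `S x ↦ ⟨J k, x⟩` is well defined because `S` is injective, and bounded because
  -- `|⟨J k, x⟩| = |⟨k, J† x⟩| ≤ ‖k‖ ‖S x‖`. After a Hahn–Banach extension, its Riesz vector `g`
  -- satisfies `⟨g, S x⟩ = ⟨J k, x⟩`, hence `S g = J k`.
  let ℓ : StrongDual ℂ (LinearMap.range (S : E →ₗ[ℂ] E)) :=
    LinearMap.mkContinuous (((innerSL ℂ (J k) : E →L[ℂ] ℂ) : E →ₗ[ℂ] ℂ) ∘ₗ e.symm.toLinearMap) ‖k‖ (by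
      intro y
      obtain ⟨x, rfl⟩ := e.surjective y
      simp only [LinearMap.comp_apply, LinearEquiv.coe_coe, LinearEquiv.symm_apply_apply]
      change ‖inner ℂ (J k) x‖ ≤ ‖k‖ * ‖S x‖
      rw [← ContinuousLinearMap.adjoint_inner_right, ← hnorm]
      exact norm_inner_le_norm _ _)
  obtain ⟨L, hL, -⟩ := exists_extension_norm_eq _ ℓ
  refine ⟨(InnerProductSpace.toDual ℂ E).symm L, ?_⟩
  refine ext_inner_right ℂ fun x => ?_
  rw [e1, InnerProductSpace.toDual_symm_apply]
  have := hL (e x)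
  change L (S x) = _ at this
  rw [this]
  change inner ℂ (J k) (e.symm (e x)) = _
  rw [LinearEquiv.symm_apply_apply]

/-- If `R = (1 + A)⁻¹ = J J†` and `R ≤ M ≤ 1`, then the range of `J` lies in the domain of
`A ^ (p / 2)`, and `A ^ p ≥ T` there, where `T` is the `p`-th power of `(1 - M) / (M + ε)`. -/
lemma exists_re_inner_le_norm_fracPow {K : Type*} [NormedAddCommGroup K] [InnerProductSpace ℂ K]
    [CompleteSpace K] {A : E →ₗ.[ℂ] E} {R M Q T : E →L[ℂ] E} (hA : IsResolvent A R) (h0 : 0 ≤ R)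
    (J : K →L[ℂ] E) (hJ : R = J.comp (ContinuousLinearMap.adjoint J)) (hRM : R ≤ M) (hM : M ≤ 1)
    {ε p : ℝ} (hε : 0 < ε) (hp : p = 1 / 2 ∨ p = 1) (hQ : Q * (M + algebraMap ℝ _ ε) = 1)
    (hQ' : (M + algebraMap ℝ _ ε) * Q = 1) (hT : 0 ≤ T)
    (hT2 : p = 1 / 2 → T * T = (1 + ε) • Q - 1) (hT1 : p = 1 → T = (1 + ε) • Q - 1) (k : K) :
    ∃ h : J k ∈ (fracPow A (p / 2)).domain,
      (inner ℂ (J k) (T (J k))).re ≤ ‖fracPow A (p / 2) ⟨J k, h⟩‖ ^ 2 := by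
  -- For these two exponents, uniqueness of the positive square root identifies the power with the
  -- concrete operator `T`.
  have hTp : ((1 + ε) • Q - 1) ^ p = T := by
    rcases hp with rfl | rfl
    · exact rpow_one_half_eq (hT2 rfl) hT
    · rw [← hT1 rfl, CFC.rpow_one T]
  have hp0 : 0 < p := by rcases hp with rfl | rfl <;> norm_num
  have hp1 : p ≤ 1 := by rcases hp with rfl | rfl <;> norm_num
  obtain ⟨g₀, hg₀⟩ := mem_range_sqrt_of_eq_mul_adjoint h0 (fun _ => hA.injective) J hJ k
  -- For `p = 1/2` the range of `R ^ (1/4)` is needed, and it contains that of `R ^ (1/2)`.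
  obtain ⟨g, hg⟩ : ∃ g, (R ^ (p / 2)) g = J k := by
    rcases hp with rfl | rfl
    · refine ⟨(R ^ (1 / 2 / 2 : ℝ)) g₀, ?_⟩
      have h := rpow_add_of_pos (R := R) (x := 1 / 2 / 2) (y := 1 / 2 / 2)
        (by norm_num) (by norm_num)
      rw [add_halves] at h
      rw [h] at hg₀
      exact hg₀
    · exact ⟨g₀, hg₀⟩
  obtain ⟨h, hh⟩ := fracPow_apply hA h0 (α := p / 2) (by linarith) (by linarith) g
  have key := re_inner_rpow_le h0 (hRM.trans hM) hRM hε hp0 hp1 hQ hQ' g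
  rw [hTp, ← hh] at key
  rw [← hg]
  exact ⟨h, key⟩

end Abstract

/-! ### Multiplication operators on `L²` -/

variable {n : ℕ}

/-- `T` is the operator of multiplication by the real function `φ`. -/
def IsMul (T : L2 n →L[ℂ] L2 n) (φ : Space n → ℝ) : Prop :=
  ∀ u : L2 n, T u =ᵐ[volume] fun x => (φ x : ℂ) * u x

lemma exists_isMul {φ : Space n → ℝ} (hφ : AEStronglyMeasurable φ volume) {C : ℝ}
    (hC : ∀ x, |φ x| ≤ C) : ∃ T : L2 n →L[ℂ] L2 n, IsMul T φ := by
  have hb : ∀ (u : L2 n) x, ‖(φ x : ℂ) * u x‖ ≤ C * ‖u x‖ := fun u x => by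
    rw [norm_mul, Complex.norm_real, Real.norm_eq_abs]
    exact mul_le_mul_of_nonneg_right (hC x) (norm_nonneg _)
  have hmem : ∀ u : L2 n, MemLp (fun x => (φ x : ℂ) * u x) 2 volume := fun u =>
    (Lp.memLp u).of_le_mul
      ((Complex.continuous_ofReal.comp_aestronglyMeasurable hφ).mul (Lp.aestronglyMeasurable u))
      (Filter.Eventually.of_forall (hb u))
  let T : L2 n →ₗ[ℂ] L2 n :=
    { toFun := fun u => (hmem u).toLp _
      map_add' := fun u v => by
        refine Lp.ext ?_
        filter_upwards [(hmem (u + v)).coeFn_toLp, (hmem u).coeFn_toLp, (hmem v).coeFn_toLp,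
          Lp.coeFn_add u v, Lp.coeFn_add ((hmem u).toLp _) ((hmem v).toLp _)] with x h1 h2 h3 h4 h5
        rw [h1, h5, Pi.add_apply, h2, h3, h4, Pi.add_apply, mul_add]
      map_smul' := fun c u => by
        refine Lp.ext ?_
        filter_upwards [(hmem (c • u)).coeFn_toLp, (hmem u).coeFn_toLp,
          Lp.coeFn_smul c u, Lp.coeFn_smul c ((hmem u).toLp _)] with x h1 h2 h4 h5
        rw [h1, RingHom.id_apply, h5, Pi.smul_apply, h2, h4, Pi.smul_apply, smul_eq_mul,
          smul_eq_mul]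
        ring }
  refine ⟨T.mkContinuous C fun u => ?_, fun u => (hmem u).coeFn_toLp⟩
  refine Lp.norm_le_mul_norm_of_ae_le_mul ?_
  filter_upwards [(hmem u).coeFn_toLp] with x hx
  change ‖((hmem u).toLp _ : L2 n) x‖ ≤ _
  rw [hx]
  exact hb u x

lemma IsMul.ext {T S : L2 n →L[ℂ] L2 n} {φ ψ : Space n → ℝ} (hT : IsMul T φ) (hS : IsMul S ψ)
    (h : φ =ᵐ[volume] ψ) : T = S := by
  ext1 u
  refine Lp.ext ?_
  filter_upwards [hT u, hS u, h] with x h1 h2 h3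
  rw [h1, h2, h3]

lemma IsMul.one : IsMul (1 : L2 n →L[ℂ] L2 n) fun _ => 1 := fun u =>
  Filter.Eventually.of_forall fun x => by simp

lemma IsMul.mul {T S : L2 n →L[ℂ] L2 n} {φ ψ : Space n → ℝ} (hT : IsMul T φ) (hS : IsMul S ψ) :
    IsMul (T * S) fun x => φ x * ψ x := fun u => by
  filter_upwards [hT (S u), hS u] with x h1 h2
  change T (S u) x = _
  rw [h1, h2]
  push_cast
  ring

lemma IsMul.add {T S : L2 n →L[ℂ] L2 n} {φ ψ : Space n → ℝ} (hT : IsMul T φ) (hS : IsMul S ψ) :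
    IsMul (T + S) fun x => φ x + ψ x := fun u => by
  filter_upwards [hT u, hS u, Lp.coeFn_add (T u) (S u)] with x h1 h2 h3
  rw [add_apply, h3, Pi.add_apply, h1, h2]
  push_cast
  ring

lemma IsMul.sub {T S : L2 n →L[ℂ] L2 n} {φ ψ : Space n → ℝ} (hT : IsMul T φ) (hS : IsMul S ψ) :
    IsMul (T - S) fun x => φ x - ψ x := fun u => by
  filter_upwards [hT u, hS u, Lp.coeFn_sub (T u) (S u)] with x h1 h2 h3
  rw [sub_apply, h3, Pi.sub_apply, h1, h2]
  push_cast
  ring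

lemma IsMul.smul {T : L2 n →L[ℂ] L2 n} {φ : Space n → ℝ} (c : ℝ) (hT : IsMul T φ) :
    IsMul (c • T) fun x => c * φ x := fun u => by
  filter_upwards [hT u, Lp.coeFn_smul c (T u)] with x h1 h3
  rw [smul_apply, h3, Pi.smul_apply, h1, Complex.real_smul]
  push_cast
  ring

lemma IsMul.algebraMap (c : ℝ) : IsMul (algebraMap ℝ (L2 n →L[ℂ] L2 n) c) fun _ => c := by
  rw [Algebra.algebraMap_eq_smul_one]
  simpa using IsMul.one.smul (n := n) c

lemma IsMul.inner_eq {T : L2 n →L[ℂ] L2 n} {φ : Space n → ℝ} (hT : IsMul T φ) (u v : L2 n) :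
    inner ℂ (T u) v = inner ℂ u (T v) := by
  rw [L2.inner_def, L2.inner_def]
  refine integral_congr_ae ?_
  filter_upwards [hT u, hT v] with x h1 h2
  rw [h1, h2]
  simp only [RCLike.inner_apply, map_mul, Complex.conj_ofReal]
  ring

lemma IsMul.inner_self {T : L2 n →L[ℂ] L2 n} {φ : Space n → ℝ} (hT : IsMul T φ) (u : L2 n) :
    inner ℂ u (T u) = ((∫ x, φ x * ‖u x‖ ^ 2 : ℝ) : ℂ) := by
  rw [L2.inner_def, ← integral_complex_ofReal]
  refine integral_congr_ae ?_
  filter_upwards [hT u] with x h1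
  rw [h1]
  simp only [RCLike.inner_apply]
  rw [mul_assoc, RCLike.mul_conj]
  push_cast
  rfl

lemma IsMul.integrable {T : L2 n →L[ℂ] L2 n} {φ : Space n → ℝ} (hT : IsMul T φ) (u : L2 n) :
    Integrable fun x => φ x * ‖u x‖ ^ 2 := by
  have h : Integrable (fun x => RCLike.re (inner ℂ (u x) ((T u) x))) :=
    (L2.integrable_inner u (T u)).re
  refine h.congr ?_
  filter_upwards [hT u] with x h1
  rw [h1]
  simp only [RCLike.inner_apply]
  rw [mul_assoc, RCLike.mul_conj]
  change ((φ x : ℂ) * ((‖u x‖ : ℝ) : ℂ) ^ 2).re = _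
  rw [← Complex.ofReal_pow, ← Complex.ofReal_mul, Complex.ofReal_re]

lemma IsMul.nonneg {T : L2 n →L[ℂ] L2 n} {φ : Space n → ℝ} (hT : IsMul T φ)
    (h : ∀ᵐ x ∂(volume : Measure (Space n)), 0 ≤ φ x) : 0 ≤ T := by
  rw [ContinuousLinearMap.nonneg_iff_isPositive]
  refine ⟨fun u v => hT.inner_eq u v, fun u => ?_⟩
  rw [ContinuousLinearMap.reApplyInnerSelf_apply, hT.inner_eq, hT.inner_self]
  change 0 ≤ (Complex.ofReal _).re
  rw [Complex.ofReal_re]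
  refine integral_nonneg_of_ae ?_
  filter_upwards [h] with x hx
  exact mul_nonneg hx (sq_nonneg _)

/-! ### The form domain as a Hilbert space -/

/-- The Hilbert space `L² × (L²)ⁿ × L²` with its Hilbert norm. -/
abbrev FormSpace (n : ℕ) : Type :=
  WithLp 2 (L2 n × WithLp 2 (PiLp 2 (fun _ : Fin n => L2 n) × L2 n))

/-- The triple underlying an element of `FormSpace n`. -/
def FormSpace.toTriple : FormSpace n →ₗ[ℂ] L2 n × ((Fin n → L2 n) × L2 n) where
  toFun p := (p.fst, (p.snd.fst.ofLp, p.snd.snd))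
  map_add' _ _ := rfl
  map_smul' _ _ := rfl

/-- The form domain with the form norm. -/
def formDomain (V : Space n → ℝ) : Submodule ℂ (FormSpace n) :=
  (formGraph V).comap FormSpace.toTriple

lemma continuous_integral_smul_test {ψ : Space n → ℝ} (hψ : Continuous ψ)
    (hc : HasCompactSupport ψ) : Continuous fun u : L2 n => ∫ x, ψ x • u x := by
  have h : MemLp (fun x => (ψ x : ℂ)) 2 (volume : Measure (Space n)) :=
    (Complex.continuous_ofReal.comp hψ).memLp_of_hasCompactSupport
      (hc.comp_left (g := Complex.ofReal) Complex.ofReal_zero)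
  have e : (fun u : L2 n => ∫ x, ψ x • u x) = fun u => inner ℂ (h.toLp _) u := by
    funext u
    rw [L2.inner_def]
    refine integral_congr_ae ?_
    filter_upwards [h.coeFn_toLp] with x hx
    rw [hx]
    simp [mul_comm]
  rw [e]
  fun_prop

lemma isClosed_isWeakDeriv (i : Fin n) : IsClosed {p : L2 n × L2 n | IsWeakDeriv i p.1 p.2} := by
  simp only [IsWeakDeriv, Set.ofPred_forall]
  refine isClosed_iInter fun φ => isClosed_iInter fun hφ => isClosed_iInter fun hc => ?_
  refine isClosed_eq ?_ ?_
  · exact (continuous_integral_smul_test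
      ((hφ.continuous_fderiv (by simp)).clm_apply continuous_const)
      (hc.fderiv_apply (𝕜 := ℝ) (EuclideanSpace.single i 1))).comp continuous_fst
  · exact ((continuous_integral_smul_test hφ.continuous hc).comp continuous_snd).neg

/-- Here `φ` may be unbounded. Multiplying the relation by `(1 + |φ|)⁻¹`, which never vanishes,
turns it into an equation between bounded operators. -/
lemma isClosed_ae_eq_mul {φ : Space n → ℝ} (hφ : AEStronglyMeasurable φ volume) :
    IsClosed {p : L2 n × L2 n | p.2 =ᵐ[volume] fun x => (φ x : ℂ) * p.1 x} := by
  have hpos : ∀ x, 0 < 1 + |φ x| := fun x => by positivity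
  obtain ⟨S, hS⟩ := exists_isMul (φ := fun x => (1 + |φ x|)⁻¹)
    ((aemeasurable_const.add hφ.aemeasurable.norm).inv.aestronglyMeasurable) (C := 1) (fun x => by
      rw [abs_of_pos (inv_pos.2 (hpos x))]
      exact inv_le_one_of_one_le₀ (by linarith [abs_nonneg (φ x)]))
  obtain ⟨T, hT⟩ := exists_isMul (φ := fun x => φ x * (1 + |φ x|)⁻¹)
    ((hφ.aemeasurable.mul (aemeasurable_const.add hφ.aemeasurable.norm).inv).aestronglyMeasurable)
    (C := 1) (fun x => by
      rw [abs_mul, abs_of_pos (inv_pos.2 (hpos x)), ← div_eq_mul_inv, div_le_one (hpos x)]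
      linarith)
  have e : {p : L2 n × L2 n | p.2 =ᵐ[volume] fun x => (φ x : ℂ) * p.1 x} =
      {p | S p.2 = T p.1} := by
    ext p
    simp only [Set.mem_ofPred_eq]
    constructor
    · intro h
      refine Lp.ext ?_
      filter_upwards [h, hS p.2, hT p.1] with x h1 h2 h3
      rw [h2, h3, h1]
      push_cast
      ring
    · intro h
      have h' : S p.2 =ᵐ[volume] T p.1 := by rw [h]
      filter_upwards [h', hS p.2, hT p.1] with x h1 h2 h3
      rw [h2, h3] at h1
      have : (((1 + |φ x|)⁻¹ : ℝ) : ℂ) ≠ 0 := by exact_mod_cast (inv_pos.2 (hpos x)).ne'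
      apply mul_left_cancel₀ this
      rw [h1]
      push_cast
      ring
  rw [e]
  exact isClosed_eq (by fun_prop) (by fun_prop)

lemma isClosed_formDomain {V : Space n → ℝ} (hV : AEStronglyMeasurable V volume) :
    IsClosed (formDomain V : Set (FormSpace n)) := by
  have e : (formDomain V : Set (FormSpace n)) =
      (⋂ i : Fin n, (fun p : FormSpace n => (p.fst, p.snd.fst.ofLp i)) ⁻¹'
        {p : L2 n × L2 n | IsWeakDeriv i p.1 p.2}) ∩
      (fun p : FormSpace n => (p.fst, p.snd.snd)) ⁻¹'
        {p : L2 n × L2 n | p.2 =ᵐ[volume] fun x => (Real.sqrt (V x) : ℂ) * p.1 x} := by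
    ext p
    simp only [Set.mem_inter_iff, Set.mem_iInter, Set.mem_preimage, Set.mem_ofPred_eq]
    rfl
  have c1 : Continuous fun p : FormSpace n => p.fst := WithLp.continuous_fst ..
  have c2 : Continuous fun p : FormSpace n => p.snd := WithLp.continuous_snd ..
  have c3 : Continuous fun p : FormSpace n => p.snd.snd := (WithLp.continuous_snd ..).comp c2
  have c4 : Continuous fun p : FormSpace n => p.snd.fst := (WithLp.continuous_fst ..).comp c2
  rw [e]
  refine IsClosed.inter (isClosed_iInter fun i => (isClosed_isWeakDeriv i).preimage ?_)
    ((isClosed_ae_eq_mul ?_).preimage (c1.prodMk c3))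
  · exact c1.prodMk ((continuous_apply i).comp ((PiLp.continuous_ofLp 2 _).comp c4))
  · exact (Real.continuous_sqrt.comp_aestronglyMeasurable hV)

/-! ### Test functions -/

/-- The weak gradient is the classical one, by parts; `√V f` is square integrable because `V` is
locally integrable and `|f|²` is continuous with compact support. -/
lemma exists_mem_formGraph_of_hasCompactSupport {V : Space n → ℝ} (hV : LocallyIntegrable V volume)
    (hV0 : ∀ᵐ x ∂(volume : Measure (Space n)), 0 ≤ V x) (f : 𝓢(Space n, ℂ))
    (hf : HasCompactSupport f) : ∃ k, (f.toLp 2 volume, k) ∈ formGraph V := by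
  have hd : ∀ i : Fin n, MemLp (fun x => fderiv ℝ f x (EuclideanSpace.single i 1)) 2
      (volume : Measure (Space n)) := fun i =>
    ((f.smooth'.continuous_fderiv (by simp)).clm_apply
      continuous_const).memLp_of_hasCompactSupport (hf.fderiv_apply (𝕜 := ℝ) _)
  have hm : MemLp (fun x => (Real.sqrt (V x) : ℂ) * f x) 2 (volume : Measure (Space n)) := by
    have hms : AEStronglyMeasurable (fun x => (Real.sqrt (V x) : ℂ) * f x)
        (volume : Measure (Space n)) :=
      (Complex.continuous_ofReal.comp_aestronglyMeasurable
        (Real.continuous_sqrt.comp_aestronglyMeasurable hV.aestronglyMeasurable)).mul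
        f.continuous.aestronglyMeasurable
    rw [memLp_two_iff_integrable_sq_norm hms]
    have hc : Continuous fun x => ‖f x‖ ^ 2 := by fun_prop
    refine (hV.integrable_smul_left_of_hasCompactSupport hc
      (hf.comp_left (g := fun z : ℂ => ‖z‖ ^ 2) (by simp))).congr ?_
    filter_upwards [hV0] with x hx
    rw [norm_mul, mul_pow, Complex.norm_real, Real.norm_eq_abs, sq_abs, Real.sq_sqrt hx,
      smul_eq_mul, mul_comm]
  refine ⟨(fun i => (hd i).toLp _, hm.toLp _), fun i φ hφ hc => ?_, ?_⟩
  · have e1 : ∫ x, fderiv ℝ φ x (EuclideanSpace.single i 1) • (f.toLp 2 volume : L2 n) x =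
        ∫ x, fderiv ℝ φ x (EuclideanSpace.single i 1) • f x := by
      refine integral_congr_ae ?_
      filter_upwards [f.coeFn_toLp 2 volume] with x hx
      rw [hx]
    have e2 : ∫ x, φ x • ((hd i).toLp _ : L2 n) x =
        ∫ x, φ x • fderiv ℝ f x (EuclideanSpace.single i 1) := by
      refine integral_congr_ae ?_
      filter_upwards [(hd i).coeFn_toLp] with x hx
      rw [hx]
    rw [e1, e2, integral_smul_fderiv_eq_neg_fderiv_smul_of_integrable, neg_neg]
    · exact (((hφ.continuous_fderiv (by simp)).clm_apply continuous_const).smul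
        f.continuous).integrable_of_hasCompactSupport (hf.smul_left)
    · exact (hφ.continuous.smul ((f.smooth'.continuous_fderiv (by simp)).clm_apply
        continuous_const)).integrable_of_hasCompactSupport hc.smul_right
    · exact (hφ.continuous.smul f.continuous).integrable_of_hasCompactSupport hf.smul_left
    · exact fun x _ => hφ.differentiable (by simp) x
    · exact fun x _ => f.differentiableAt
  · filter_upwards [f.coeFn_toLp 2 volume, hm.coeFn_toLp] with x h1 h2
    rw [h1, h2]

lemma eq_zero_of_integral_test_smul_eq_zero {w : L2 n} (h : ∀ φ : Space n → ℝ, ContDiff ℝ ∞ φ →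
    HasCompactSupport φ → ∫ x, φ x • w x = 0) : w = 0 := by
  refine Lp.ext ?_
  filter_upwards [ae_eq_zero_of_integral_contDiff_smul_eq_zero
    ((Lp.memLp w).locallyIntegrable (by norm_num)) h,
    Lp.coeFn_zero ℂ 2 (volume : Measure (Space n))] with x h1 h2
  rw [h1, h2, Pi.zero_apply]

lemma eq_zero_of_mem_formGraph {V : Space n → ℝ} {k : (Fin n → L2 n) × L2 n}
    (hk : ((0 : L2 n), k) ∈ formGraph V) : k = 0 := by
  obtain ⟨h1, h2⟩ := hk
  refine Prod.ext (funext fun i => eq_zero_of_integral_test_smul_eq_zero fun φ hφ hc => ?_) ?_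
  · have h3 := h1 i φ hφ hc
    have h4 := IsWeakDeriv.zero i φ hφ hc
    dsimp only at h3 h4
    rw [h4] at h3
    have h5 : ∫ x, φ x • (0 : L2 n) x = 0 := by
      rw [← integral_zero (Space n) ℂ]
      refine integral_congr_ae ?_
      filter_upwards [Lp.coeFn_zero ℂ 2 (volume : Measure (Space n))] with x hx
      rw [hx, Pi.zero_apply, smul_zero]
    rw [h5, neg_zero, eq_comm, neg_eq_zero] at h3
    exact h3
  · refine Lp.ext ?_
    filter_upwards [h2, Lp.coeFn_zero ℂ 2 (volume : Measure (Space n))] with x h3 h4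
    rw [h3, Prod.snd_zero, h4]
    simp

/-- Single-valuedness: if `u = 0`, its form data vanish, so `w` is orthogonal to all real test
functions. It ensures that `hamiltonian V` has exactly this graph. -/
lemma hamiltonianGraph_snd_eq_zero {V : Space n → ℝ} (hV : LocallyIntegrable V volume)
    (hV0 : ∀ᵐ x ∂(volume : Measure (Space n)), 0 ≤ V x) :
    ∀ x ∈ hamiltonianGraph V, x.1 = 0 → x.2 = 0 := by
  rintro ⟨u, w⟩ ⟨k, hk, h⟩ hu
  dsimp only at hu hk h ⊢
  subst hu
  obtain rfl := eq_zero_of_mem_formGraph hk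
  refine eq_zero_of_integral_test_smul_eq_zero fun φ hφ hc => ?_
  have hcs : HasCompactSupport fun x => (φ x : ℂ) :=
    hc.comp_left (g := Complex.ofReal) Complex.ofReal_zero
  let f : 𝓢(Space n, ℂ) := hcs.toSchwartzMap (Complex.ofRealCLM.contDiff.comp hφ)
  obtain ⟨l, hl⟩ := exists_mem_formGraph_of_hasCompactSupport hV hV0 f hcs
  have h1 := h _ _ hl
  have h2 : formInner l 0 = 0 := by simp [formInner]
  rw [h2, L2.inner_def] at h1
  rw [h1]
  refine integral_congr_ae ?_
  filter_upwards [f.coeFn_toLp 2 volume] with x hx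
  rw [hx]
  change φ x • w x = inner ℂ (φ x : ℂ) (w x)
  simp [mul_comm]

/-! ### The resolvent of the Hamiltonian -/

/-- The form domain with the form norm, as a type. -/
def FormDomain (V : Space n → ℝ) : Type := formDomain V

instance (V : Space n → ℝ) : NormedAddCommGroup (FormDomain V) :=
  inferInstanceAs (NormedAddCommGroup (formDomain V))

instance (V : Space n → ℝ) : InnerProductSpace ℂ (FormDomain V) :=
  inferInstanceAs (InnerProductSpace ℂ (formDomain V))

lemma completeSpace_formDomain {V : Space n → ℝ} (hV : AEStronglyMeasurable V volume) :
    CompleteSpace (FormDomain V) :=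
  (isClosed_formDomain hV).completeSpace_coe

/-- The inclusion of the form domain into `L²`. -/
def formInclusion (V : Space n → ℝ) : FormDomain V →L[ℂ] L2 n :=
  LinearMap.mkContinuous
    { toFun := fun p => p.1.fst
      map_add' := fun _ _ => rfl
      map_smul' := fun _ _ => rfl } 1 fun p => by
    rw [one_mul]
    exact WithLp.norm_fst_le _ p.1

lemma formDomain_inner {V : Space n → ℝ} (p q : FormDomain V) :
    inner ℂ p q = inner ℂ p.1 q.1 := rfl

lemma formDomain_norm_sq {V : Space n → ℝ} (p : FormDomain V) : ‖p‖ ^ 2 =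
    ‖p.1.fst‖ ^ 2 + (‖p.1.snd.fst‖ ^ 2 + ‖p.1.snd.snd‖ ^ 2) := by
  change ‖p.1‖ ^ 2 = _
  rw [WithLp.prod_norm_sq_eq_of_L2, WithLp.prod_norm_sq_eq_of_L2]

lemma formSpace_inner (p q : FormSpace n) : inner ℂ p q =
    inner ℂ p.fst q.fst + formInner (FormSpace.toTriple p).2 (FormSpace.toTriple q).2 := by
  rw [WithLp.prod_inner_apply, WithLp.prod_inner_apply, PiLp.inner_apply]
  rfl

/-- The element of the form domain given by a point of the form graph. -/
def formDomainMk {V : Space n → ℝ} {v : L2 n} {l : (Fin n → L2 n) × L2 n}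
    (h : (v, l) ∈ formGraph V) : FormDomain V :=
  ⟨WithLp.toLp 2 (v, WithLp.toLp 2 (WithLp.toLp 2 l.1, l.2)), h⟩

/-- The resolvent `(1 + H)⁻¹` as `J J†`, for the inclusion `J` of the form domain. -/
def formResolvent (V : Space n → ℝ) [CompleteSpace (FormDomain V)] : L2 n →L[ℂ] L2 n :=
  (formInclusion V).comp (ContinuousLinearMap.adjoint (formInclusion V))

/-- The vector `q = J† x` is characterised by `⟨p, q⟩ = ⟨J p, x⟩` in the form inner product. As this
inner product is the form plus the `L²` one, that is the weak form of `(1 + H) q = x`. -/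
lemma isResolvent_formResolvent {V : Space n → ℝ} [CompleteSpace (FormDomain V)]
    (hV : LocallyIntegrable V volume)
    (hV0 : ∀ᵐ x ∂(volume : Measure (Space n)), 0 ≤ V x) :
    IsResolvent (hamiltonian V) (formResolvent V) := by
  intro x y
  rw [hamiltonian, Submodule.toLinearPMap_graph_eq _ (hamiltonianGraph_snd_eq_zero hV hV0)]
  constructor
  · rintro rfl
    set q := ContinuousLinearMap.adjoint (formInclusion V) x with hq
    refine ⟨(FormSpace.toTriple q.1).2, q.2, fun v l hl => ?_⟩
    have h1 : inner ℂ (formDomainMk hl) q = inner ℂ v x :=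
      ContinuousLinearMap.adjoint_inner_right (formInclusion V) (formDomainMk hl) x
    rw [formDomain_inner, formSpace_inner] at h1
    rw [inner_sub_right, ← h1]
    exact (add_sub_cancel_left _ _).symm
  · rintro ⟨k, hk, h⟩
    have e : ContinuousLinearMap.adjoint (formInclusion V) x = formDomainMk hk := by
      refine ext_inner_left ℂ fun p => ?_
      rw [ContinuousLinearMap.adjoint_inner_right, formDomain_inner, formSpace_inner]
      have h1 := h p.1.fst (FormSpace.toTriple p.1).2 p.2
      rw [inner_sub_right] at h1
      change _ = inner ℂ p.1.fst y + formInner (FormSpace.toTriple p.1).2 k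
      rw [h1, add_sub_cancel]
      rfl
    change formInclusion V (ContinuousLinearMap.adjoint (formInclusion V) x) = y
    rw [e]
    rfl

lemma formResolvent_nonneg (V : Space n → ℝ) [CompleteSpace (FormDomain V)] :
    0 ≤ formResolvent V := by
  rw [ContinuousLinearMap.nonneg_iff_isPositive]
  exact ContinuousLinearMap.isPositive_self_comp_adjoint _

/-- This is antitonicity of inversion for `1 + H ≥ 1 + V`, done by hand since both sides are
unbounded. With `u = R h`, `w = √V u` and `N = √V / (1 + V)`, one has `u = M u + N w` and `M = M² +
N²`, and the form norm of `J† h` controls `u` and `w`. -/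
lemma formResolvent_le_mul {V : Space n → ℝ} [CompleteSpace (FormDomain V)]
    (hV : AEStronglyMeasurable V volume)
    (hV0 : ∀ᵐ x ∂(volume : Measure (Space n)), 0 ≤ V x) {M : L2 n →L[ℂ] L2 n}
    (hM : IsMul M fun x => (1 + |V x|)⁻¹) : formResolvent V ≤ M := by
  have hpos : ∀ x, 0 < 1 + |V x| := fun x => by positivity
  obtain ⟨N, hN⟩ := exists_isMul (φ := fun x => (1 + |V x|)⁻¹ * Real.sqrt (V x))
    (((aemeasurable_const.add hV.aemeasurable.norm).inv.mul
      hV.aemeasurable.sqrt).aestronglyMeasurable) (C := 1) (fun x => by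
      rw [abs_of_nonneg (mul_nonneg (inv_pos.2 (hpos x)).le (Real.sqrt_nonneg _)),
        inv_mul_le_iff₀ (hpos x), mul_one]
      refine (Real.sqrt_le_left (by positivity)).2 ?_
      nlinarith [le_abs_self (V x), abs_nonneg (V x)])
  have hMN : M * M + N * N = M := by
    refine ((hM.mul hM).add (hN.mul hN)).ext hM ?_
    filter_upwards [hV0] with x hx
    have h1 := hpos x
    rw [abs_of_nonneg hx] at h1 ⊢
    have h2 : (1 + V x)⁻¹ * Real.sqrt (V x) * ((1 + V x)⁻¹ * Real.sqrt (V x)) =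
        (1 + V x)⁻¹ * (1 + V x)⁻¹ * (Real.sqrt (V x) * Real.sqrt (V x)) := by ring
    rw [h2, Real.mul_self_sqrt hx]
    field_simp
  have hRsa := (formResolvent_nonneg V).isSelfAdjoint
  rw [ContinuousLinearMap.le_def]
  refine ⟨fun u v => ?_, fun h => ?_⟩
  · change inner ℂ (M u - formResolvent V u) v = inner ℂ u (M v - formResolvent V v)
    rw [inner_sub_left, inner_sub_right, hM.inner_eq, ← ContinuousLinearMap.adjoint_inner_right,
      hRsa.adjoint_eq]
  set k := ContinuousLinearMap.adjoint (formInclusion V) h with hk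
  set u := k.1.fst with hu
  set w := k.1.snd.snd with hw
  have hwu : w =ᵐ[volume] fun x => (Real.sqrt (V x) : ℂ) * u x := k.2.2
  have hRu : formResolvent V h = u := rfl
  have huw : u = M u + N w := by
    refine Lp.ext ?_
    filter_upwards [hM u, hN w, hwu, Lp.coeFn_add (M u) (N w), hV0] with x h1 h2 h3 h4 h5
    rw [h4, Pi.add_apply, h1, h2, h3]
    have e : ((1 + |V x|)⁻¹ + (1 + |V x|)⁻¹ * Real.sqrt (V x) * Real.sqrt (V x) : ℝ) = 1 := by
      rw [mul_assoc, Real.mul_self_sqrt h5]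
      have h1 := hpos x
      rw [abs_of_nonneg h5] at h1 ⊢
      field_simp
    have e' := congrArg (fun r : ℝ => (r : ℂ)) e
    push_cast at e'
    push_cast
    linear_combination (-(u x)) * e'
  have hkk : (inner ℂ h u).re = ‖k‖ ^ 2 := by
    rw [← inner_self_eq_norm_sq (𝕜 := ℂ), hk, ContinuousLinearMap.adjoint_inner_left]
    rfl
  have hku : ‖u‖ ^ 2 + ‖w‖ ^ 2 ≤ ‖k‖ ^ 2 := by
    rw [formDomain_norm_sq]
    nlinarith [sq_nonneg ‖k.1.snd.fst‖]
  have h1 : (inner ℂ h u).re ≤ ‖M h‖ * ‖u‖ + ‖N h‖ * ‖w‖ := by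
    conv_lhs => rw [huw]
    rw [inner_add_right, ← hM.inner_eq, ← hN.inner_eq, Complex.add_re]
    exact add_le_add (re_inner_le_norm (𝕜 := ℂ) _ _) (re_inner_le_norm (𝕜 := ℂ) _ _)
  have h2 : (inner ℂ h (M h)).re = ‖M h‖ ^ 2 + ‖N h‖ ^ 2 := by
    conv_lhs => rw [← hMN]
    change (inner ℂ h (M (M h) + N (N h))).re = _
    rw [inner_add_right, ← hM.inner_eq, ← hN.inner_eq, Complex.add_re,
      ← inner_self_eq_norm_sq (𝕜 := ℂ), ← inner_self_eq_norm_sq (𝕜 := ℂ)]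
    rfl
  rw [ContinuousLinearMap.reApplyInnerSelf_apply, ← inner_conj_symm, RCLike.conj_re]
  change 0 ≤ (inner ℂ h (M h - formResolvent V h)).re
  rw [inner_sub_right, Complex.sub_re, hRu]
  -- With `a = ⟨h, R h⟩ ≥ ‖u‖² + ‖w‖²`, Young's inequality gives `a ≤ (⟨h, M h⟩ + a) / 2`, hence `a
  -- ≤ ⟨h, M h⟩`.
  nlinarith [sq_nonneg (‖M h‖ - ‖u‖), sq_nonneg (‖N h‖ - ‖w‖)]

/-! ### Lower bound for the fractional powers by the potential -/

/-- The bounded approximation `V / (1 + ε + ε V)` of the potential `V`, for `V ≥ 0`. -/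
def truncation (V : Space n → ℝ) (ε : ℝ) (x : Space n) : ℝ :=
  (1 + ε) * ((1 + |V x|)⁻¹ + ε)⁻¹ - 1

lemma truncation_nonneg (V : Space n → ℝ) {ε : ℝ} (hε : 0 < ε) (x : Space n) :
    0 ≤ truncation V ε x := by
  have h1 : (1 + |V x|)⁻¹ ≤ 1 := inv_le_one_of_one_le₀ (by linarith [abs_nonneg (V x)])
  have h2 : 0 < (1 + |V x|)⁻¹ := by positivity
  rw [truncation, sub_nonneg, ← div_eq_mul_inv, one_le_div (by positivity)]
  linarith

/-- The form bound `H ^ p ≥ V ^ p` with truncated `V`, evaluated on test functions. It also places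
them in the domain of `H ^ (p/2)`, so the norm equivalence can be applied to them. -/
lemma integral_truncation_le {V : Space n → ℝ} (hV : LocallyIntegrable V volume)
    (hV0 : ∀ᵐ x ∂(volume : Measure (Space n)), 0 ≤ V x) {p : ℝ} (hp : p = 1 / 2 ∨ p = 1)
    {ε : ℝ} (hε : 0 < ε) (f : 𝓢(Space n, ℂ)) (hf : HasCompactSupport f) :
    Integrable (fun x => truncation V ε x ^ p * ‖f x‖ ^ 2) ∧
    ∃ h : f.toLp 2 volume ∈ (fracPow (hamiltonian V) (p / 2)).domain,
      ∫ x, truncation V ε x ^ p * ‖f x‖ ^ 2 ≤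
        ‖fracPow (hamiltonian V) (p / 2) ⟨f.toLp 2 volume, h⟩‖ ^ 2 := by
  have hp0 : 0 < p := by rcases hp with rfl | rfl <;> norm_num
  have hVm := hV.aestronglyMeasurable
  have := completeSpace_formDomain hVm
  have hR := isResolvent_formResolvent hV hV0
  have hR0 := formResolvent_nonneg V
  have hpos : ∀ x, 0 < (1 + |V x|)⁻¹ := fun x => by positivity
  have hle1 : ∀ x, (1 + |V x|)⁻¹ ≤ 1 := fun x =>
    inv_le_one_of_one_le₀ (by linarith [abs_nonneg (V x)])
  have hmeas : AEMeasurable (fun x => (1 + |V x|)⁻¹) volume :=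
    (aemeasurable_const.add hVm.aemeasurable.norm).inv
  obtain ⟨M, hM⟩ := exists_isMul (φ := fun x => (1 + |V x|)⁻¹) hmeas.aestronglyMeasurable (C := 1)
    (fun x => by rw [abs_of_pos (hpos x)]; exact hle1 x)
  have hRM := formResolvent_le_mul hVm hV0 hM
  have hM1 : M ≤ 1 := sub_nonneg.1
    ((IsMul.one.sub hM).nonneg (Filter.Eventually.of_forall fun x => sub_nonneg.2 (hle1 x)))
  have hbd : ∀ x, ((1 + |V x|)⁻¹ + ε)⁻¹ ≤ ε⁻¹ := fun x =>
    inv_anti₀ hε (by linarith [hpos x])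
  obtain ⟨Q, hQ⟩ := exists_isMul (φ := fun x => ((1 + |V x|)⁻¹ + ε)⁻¹)
    (hmeas.add_const ε).inv.aestronglyMeasurable (C := ε⁻¹)
    (fun x => by
      have := hpos x
      rw [abs_of_pos (by positivity)]
      exact hbd x)
  have hne : ∀ x, (1 + |V x|)⁻¹ + ε ≠ 0 := fun x => (add_pos (hpos x) hε).ne'
  have hMε := hM.add (IsMul.algebraMap ε)
  have hQ1 : Q * (M + algebraMap ℝ _ ε) = 1 := (hQ.mul hMε).ext IsMul.one
    (Filter.Eventually.of_forall fun x => inv_mul_cancel₀ (hne x))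
  have hQ2 : (M + algebraMap ℝ _ ε) * Q = 1 := (hMε.mul hQ).ext IsMul.one
    (Filter.Eventually.of_forall fun x => mul_inv_cancel₀ (hne x))
  have hW : IsMul ((1 + ε) • Q - 1) (truncation V ε) := (hQ.smul (1 + ε)).sub IsMul.one
  have hτ := truncation_nonneg V hε
  obtain ⟨T, hT⟩ := exists_isMul (φ := fun x => truncation V ε x ^ p)
    ((((hmeas.add_const ε).inv.const_mul (1 + ε)).sub_const 1).pow_const p).aestronglyMeasurable
    (C := ((1 + ε) * ε⁻¹) ^ p) (fun x => by
      rw [abs_of_nonneg (Real.rpow_nonneg (hτ x) p)]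
      exact Real.rpow_le_rpow (hτ x) ((sub_le_self _ zero_le_one).trans
        (mul_le_mul_of_nonneg_left (hbd x) (by positivity))) hp0.le)
  obtain ⟨l, hl⟩ := exists_mem_formGraph_of_hasCompactSupport hV hV0 f hf
  obtain ⟨h, key⟩ := exists_re_inner_le_norm_fracPow hR hR0 (formInclusion V) rfl hRM hM1 hε hp
    hQ1 hQ2 (hT.nonneg (Filter.Eventually.of_forall fun x => Real.rpow_nonneg (hτ x) p))
    (fun hp => (hT.mul hT).ext hW (Filter.Eventually.of_forall fun x => by
      beta_reduce
      rw [← Real.rpow_add_of_nonneg (hτ x) hp0.le hp0.le, hp, add_halves, Real.rpow_one]))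
    (fun hp => hT.ext hW (Filter.Eventually.of_forall fun x => by
      beta_reduce
      rw [hp, Real.rpow_one]))
    (formDomainMk hl)
  have hcongr : (fun x => truncation V ε x ^ p * ‖(f.toLp 2 volume : L2 n) x‖ ^ 2) =ᵐ[volume]
      fun x => truncation V ε x ^ p * ‖f x‖ ^ 2 := by
    filter_upwards [f.coeFn_toLp 2 volume] with x hx
    rw [hx]
  refine ⟨(hT.integrable _).congr hcongr, h, ?_⟩
  rw [← integral_congr_ae hcongr]
  change (inner ℂ (f.toLp 2 volume : L2 n) (T (f.toLp 2 volume))).re ≤ _ at key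
  rwa [hT.inner_self, Complex.ofReal_re] at key

/-! ### Test functions with small critical homogeneous norm -/

lemma fourier_comp_inv_smul (g : Space n → ℂ) {c : ℝ} (hc : 0 < c) (ξ : Space n) :
    𝓕 (fun x => g (c⁻¹ • x)) ξ = (c ^ n : ℝ) • 𝓕 g (c • ξ) := by
  rw [Real.fourier_eq, Real.fourier_eq]
  have h := Measure.integral_comp_inv_smul (volume : Measure (Space n))
    (fun y => Real.fourierChar (-inner ℝ y (c • ξ)) • g y) c
  rw [finrank_euclideanSpace_fin, abs_of_pos (pow_pos hc n)] at h
  rw [← h]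
  refine integral_congr_ae (Filter.Eventually.of_forall fun x => ?_)
  beta_reduce
  rw [inner_smul_left, inner_smul_right]
  simp [hc.ne']

/-- The Schwartz function `x ↦ φ (c⁻¹ x)`, for a bump function `φ`. -/
def dilatedBump (φ : ContDiffBump (0 : Space n)) {c : ℝ} (hc : c ≠ 0) : 𝓢(Space n, ℂ) :=
  HasCompactSupport.toSchwartzMap (f := fun x : Space n => ((φ (c⁻¹ • x) : ℝ) : ℂ))
    ((φ.hasCompactSupport.comp_smul (inv_ne_zero hc)).comp_left (g := Complex.ofReal)
      Complex.ofReal_zero)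
    (Complex.ofRealCLM.contDiff.comp (φ.contDiff.comp (contDiff_const_smul _)))

lemma dilatedBump_apply (φ : ContDiffBump (0 : Space n)) {c : ℝ} (hc : c ≠ 0) (x : Space n) :
    dilatedBump φ hc x = (φ (c⁻¹ • x) : ℝ) := rfl

lemma hasCompactSupport_dilatedBump (φ : ContDiffBump (0 : Space n)) {c : ℝ} (hc : c ≠ 0) :
    HasCompactSupport (dilatedBump φ hc) :=
  (φ.hasCompactSupport.comp_smul (inv_ne_zero hc)).comp_left (g := Complex.ofReal)
    Complex.ofReal_zero

/-- The average of the first `N` dyadic dilations of a bump function. -/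
def averagedBump (φ : ContDiffBump (0 : Space n)) (N : ℕ) : 𝓢(Space n, ℂ) :=
  ((N : ℂ)⁻¹) • ∑ j ∈ Finset.range N, dilatedBump φ (c := 2 ^ j) (by positivity)

lemma averagedBump_apply (φ : ContDiffBump (0 : Space n)) (N : ℕ) (x : Space n) :
    averagedBump φ N x =
      (((N : ℝ)⁻¹ * ∑ j ∈ Finset.range N, φ (((2 : ℝ) ^ j)⁻¹ • x) : ℝ) : ℂ) := by
  simp [averagedBump, dilatedBump_apply, sum_apply]

lemma hasCompactSupport_averagedBump (φ : ContDiffBump (0 : Space n)) (N : ℕ) :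
    HasCompactSupport (averagedBump φ N) := by
  have h : ∀ s : Finset ℕ, HasCompactSupport
      (∑ j ∈ s, dilatedBump φ (c := 2 ^ j) (by positivity) : 𝓢(Space n, ℂ)) := by
    intro s
    induction s using Finset.induction_on with
    | empty => simpa using HasCompactSupport.zero
    | insert a s ha ih =>
      rw [Finset.sum_insert ha]
      exact (hasCompactSupport_dilatedBump φ _).add ih
  exact (h _).smul_left (f := fun _ => (N : ℂ)⁻¹)

lemma tendsto_averagedBump (φ : ContDiffBump (0 : Space n)) (x : Space n) :
    Filter.Tendsto (fun N => ‖averagedBump φ N x‖ ^ 2) Filter.atTop (nhds 1) := by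
  have h1 : Filter.Tendsto (fun j : ℕ => φ (((2 : ℝ) ^ j)⁻¹ • x)) Filter.atTop (nhds 1) := by
    have h2 : Filter.Tendsto (fun j : ℕ => ((2 : ℝ) ^ j)⁻¹ • x) Filter.atTop (nhds 0) := by
      have := (tendsto_inv_atTop_zero.comp
        (tendsto_pow_atTop_atTop_of_one_lt (one_lt_two (α := ℝ)))).smul_const x
      simpa using this
    have h3 : φ (0 : Space n) = 1 :=
      φ.one_of_mem_closedBall (Metric.mem_closedBall_self φ.rIn_pos.le)
    rw [← h3]
    exact (φ.continuous.tendsto 0).comp h2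
  have h4 := h1.cesaro.norm.pow 2
  simp only [norm_one, one_pow] at h4
  refine h4.congr fun N => ?_
  rw [averagedBump_apply, Complex.norm_real]

/-- A pointwise form of almost orthogonality. The geometric growth gives `∑_{j<N} a j ≤ 2 ^ (N n)
B`, so adding `a N` raises the square by `2 S a_N + a_N² ≤ 3 B 2 ^ (N n) a_N`, with `S` the previous
sum. -/
lemma sq_sum_le_of_le_two_pow {a : ℕ → ℝ} {B : ℝ} (ha : ∀ j, 0 ≤ a j)
    (hB : ∀ j, a j ≤ ((2 : ℝ) ^ j) ^ n * B) (hn : 1 ≤ n) (N : ℕ) :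
    (∑ j ∈ Finset.range N, a j) ^ 2 ≤
      3 * B * ∑ j ∈ Finset.range N, ((2 : ℝ) ^ j) ^ n * a j := by
  have hB0 : 0 ≤ B := by simpa using (ha 0).trans (hB 0)
  have hS : ∀ N, ∑ j ∈ Finset.range N, a j ≤ ((2 : ℝ) ^ N) ^ n * B := by
    intro N
    induction N with
    | zero => simpa using hB0
    | succ N ih =>
      rw [Finset.sum_range_succ]
      have h2 : (2 : ℝ) ≤ 2 ^ n := le_self_pow₀ one_le_two (by omega)
      have h3 : ((2 : ℝ) ^ (N + 1)) ^ n = ((2 : ℝ) ^ N) ^ n * 2 ^ n := by rw [pow_succ, mul_pow]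
      have h4 : 0 ≤ ((2 : ℝ) ^ N) ^ n * B := by positivity
      rw [h3]
      nlinarith [hB N]
  induction N with
  | zero => simp
  | succ N ih =>
    rw [Finset.sum_range_succ, Finset.sum_range_succ]
    nlinarith [mul_le_mul_of_nonneg_right (hS N) (ha N), mul_le_mul_of_nonneg_right (hB N) (ha N)]

lemma norm_fourier_averagedBump_le (φ : ContDiffBump (0 : Space n)) (N : ℕ) (ξ : Space n) :
    ‖𝓕 (averagedBump φ N : Space n → ℂ) ξ‖ ≤ (N : ℝ)⁻¹ * ∑ j ∈ Finset.range N,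
      ((2 : ℝ) ^ j) ^ n * ‖𝓕 (dilatedBump φ one_ne_zero) ((2 : ℝ) ^ j • ξ)‖ := by
  have h : ∀ j : ℕ, 𝓕 (dilatedBump φ (c := 2 ^ j) (by positivity)) ξ =
      (((2 : ℝ) ^ j) ^ n : ℝ) • 𝓕 (dilatedBump φ one_ne_zero) ((2 : ℝ) ^ j • ξ) := fun j => by
    rw [SchwartzMap.fourier_coe, SchwartzMap.fourier_coe,
      ← fourier_comp_inv_smul _ (by positivity : (0 : ℝ) < 2 ^ j)]
    refine congrArg (fun g : Space n → ℂ => 𝓕 g ξ) (funext fun x => ?_)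
    rw [dilatedBump_apply, dilatedBump_apply, inv_one, one_smul]
  rw [← SchwartzMap.fourier_coe, averagedBump, FourierTransform.fourier_smul,
    FourierTransform.fourier_sum, smul_apply, sum_apply, norm_smul, norm_inv, Complex.norm_natCast]
  refine mul_le_mul_of_nonneg_left ((norm_sum_le _ _).trans (Finset.sum_le_sum fun j _ => ?_))
    (by positivity)
  rw [h, norm_smul, Real.norm_of_nonneg (by positivity)]

/-- After `sq_sum_le_of_le_two_pow` only a single sum over scales remains. The weight `‖ξ‖ ^ n`
makes each term integrate to the same `I`, so `N` terms against the factor `N⁻²` leave `N⁻¹`. -/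
lemma exists_freeNorm_averagedBump_le (hn : 1 ≤ n) (φ : ContDiffBump (0 : Space n)) :
    ∃ K : ℝ, ∀ N : ℕ, freeNorm ((n : ℝ) / 2) (averagedBump φ N) ^ 2 ≤ K * (N : ℝ)⁻¹ := by
  set F : 𝓢(Space n, ℂ) := 𝓕 (dilatedBump φ one_ne_zero) with hF
  set B : ℝ := SchwartzMap.seminorm ℂ 0 0 F with hB
  set I : ℝ := ∫ η : Space n, ‖η‖ ^ n * ‖F η‖ with hI
  have hBF : ∀ η, ‖F η‖ ≤ B := fun η => SchwartzMap.norm_le_seminorm ℂ F η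
  refine ⟨(2 * Real.pi) ^ n * (3 * B) * I, fun N => ?_⟩
  have hint : ∀ j : ℕ, Integrable fun ξ : Space n =>
      ‖(2 : ℝ) ^ j • ξ‖ ^ n * ‖F ((2 : ℝ) ^ j • ξ)‖ := fun j =>
    (integrable_comp_smul_iff volume (fun η => ‖η‖ ^ n * ‖F η‖)
      (by positivity : ((2 : ℝ) ^ j) ≠ 0)).2 (F.integrable_pow_mul volume n)
  have hval : ∀ j : ℕ, ∫ ξ : Space n, ((2 : ℝ) ^ j) ^ n *
      (‖(2 : ℝ) ^ j • ξ‖ ^ n * ‖F ((2 : ℝ) ^ j • ξ)‖) = I := fun j => by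
    rw [integral_const_mul, Measure.integral_comp_smul volume (fun η => ‖η‖ ^ n * ‖F η‖),
      finrank_euclideanSpace_fin, abs_of_pos (by positivity), smul_eq_mul, ← mul_assoc,
      mul_inv_cancel₀ (by positivity), one_mul]
  have hpt : ∀ ξ : Space n, ((2 * Real.pi * ‖ξ‖) ^ ((n : ℝ) / 2) *
      ‖𝓕 (averagedBump φ N : Space n → ℂ) ξ‖) ^ 2 ≤ (2 * Real.pi) ^ n * (3 * B) * ((N : ℝ)⁻¹) ^ 2 *
        ∑ j ∈ Finset.range N, ((2 : ℝ) ^ j) ^ n *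
          (‖(2 : ℝ) ^ j • ξ‖ ^ n * ‖F ((2 : ℝ) ^ j • ξ)‖) := fun ξ => by
    have h1 := norm_fourier_averagedBump_le φ N ξ
    have h2 := sq_sum_le_of_le_two_pow
      (a := fun j => ((2 : ℝ) ^ j) ^ n * ‖F ((2 : ℝ) ^ j • ξ)‖) (B := B)
      (fun j => by positivity)
      (fun j => mul_le_mul_of_nonneg_left (hBF _) (by positivity)) hn N
    have h3 : ((2 * Real.pi * ‖ξ‖) ^ ((n : ℝ) / 2)) ^ 2 = (2 * Real.pi) ^ n * ‖ξ‖ ^ n := by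
      rw [← Real.rpow_natCast, ← Real.rpow_mul (by positivity), ← mul_pow, ← Real.rpow_natCast]
      congr 1
      push_cast
      ring
    rw [mul_pow, h3]
    calc (2 * Real.pi) ^ n * ‖ξ‖ ^ n * ‖𝓕 (averagedBump φ N : Space n → ℂ) ξ‖ ^ 2
        ≤ (2 * Real.pi) ^ n * ‖ξ‖ ^ n * ((N : ℝ)⁻¹ * ∑ j ∈ Finset.range N,
          ((2 : ℝ) ^ j) ^ n * ‖F ((2 : ℝ) ^ j • ξ)‖) ^ 2 := by gcongr
      _ ≤ (2 * Real.pi) ^ n * ‖ξ‖ ^ n * (((N : ℝ)⁻¹) ^ 2 * (3 * B * ∑ j ∈ Finset.range N,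
          ((2 : ℝ) ^ j) ^ n * (((2 : ℝ) ^ j) ^ n * ‖F ((2 : ℝ) ^ j • ξ)‖))) := by
        rw [mul_pow (N : ℝ)⁻¹]
        gcongr
      _ = _ := by
        simp only [Finset.mul_sum]
        refine Finset.sum_congr rfl fun j _ => ?_
        rw [norm_smul, Real.norm_of_nonneg (by positivity), mul_pow]
        ring
  rw [freeNorm, Real.sq_sqrt (integral_nonneg fun ξ => sq_nonneg _)]
  refine (integral_mono_of_nonneg (Filter.Eventually.of_forall fun ξ => sq_nonneg _)
    ((integrable_finsetSum _ fun j _ => (hint j).const_mul _).const_mul _)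
    (Filter.Eventually.of_forall hpt)).trans (le_of_eq ?_)
  rw [integral_const_mul, integral_finsetSum _ fun j _ => (hint j).const_mul _]
  simp only [hval, Finset.sum_const, Finset.card_range, nsmul_eq_mul]
  rcases eq_or_ne N 0 with rfl | hN
  · simp
  · have : (N : ℝ) ≠ 0 := by exact_mod_cast hN
    field_simp

/-! ### Passage to the limit by Fatou's lemma -/

lemma tendsto_truncation (V : Space n → ℝ) (x : Space n) :
    Filter.Tendsto (fun N : ℕ => truncation V ((N : ℝ) + 1)⁻¹ x) Filter.atTop (nhds |V x|) := by
  have h : Filter.Tendsto (fun N : ℕ => ((N : ℝ) + 1)⁻¹) Filter.atTop (nhds 0) := by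
    simpa using tendsto_one_div_add_atTop_nhds_zero_nat (𝕜 := ℝ)
  have hpos : 0 < (1 + |V x|)⁻¹ := by positivity
  have h2 := ((h.const_add 1).mul ((h.const_add (1 + |V x|)⁻¹).inv₀ (by simpa using hpos.ne'))
    ).sub_const 1
  simpa [truncation] using h2

lemma ae_eq_zero_of_homNormEquiv (hn : n = 1 ∨ n = 2) {V : Space n → ℝ}
    (hV : LocallyIntegrable V volume) (hV0 : ∀ᵐ x ∂(volume : Measure (Space n)), 0 ≤ V x)
    (h : HomNormEquiv V ((n : ℝ) / 2)) : V =ᵐ[volume] 0 := by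
  obtain ⟨c, C, -, hC, h⟩ := h
  let φ : ContDiffBump (0 : Space n) := ⟨1, 2, one_pos, one_lt_two⟩
  obtain ⟨K, hK⟩ := exists_freeNorm_averagedBump_le (by omega) φ
  have hp : (n : ℝ) / 2 = 1 / 2 ∨ (n : ℝ) / 2 = 1 := by
    rcases hn with rfl | rfl <;> norm_num
  have hp0 : 0 < (n : ℝ) / 2 := by rcases hp with h | h <;> rw [h] <;> norm_num
  set p := (n : ℝ) / 2 with hpdef
  have hε : ∀ N : ℕ, 0 < ((N : ℝ) + 1)⁻¹ := fun N => by positivity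
  -- One index drives both limits: the truncation tends to `|V|` while the test function tends to
  -- `1`, so a single use of Fatou's lemma suffices.
  set G : ℕ → Space n → ℝ := fun N x =>
    truncation V ((N : ℝ) + 1)⁻¹ x ^ p * ‖averagedBump φ N x‖ ^ 2 with hG
  have hGint : ∀ N, Integrable (G N) := fun N =>
    (integral_truncation_le hV hV0 hp (hε N) _ (hasCompactSupport_averagedBump φ N)).1
  have hG0 : ∀ N x, 0 ≤ G N x := fun N x =>
    mul_nonneg (Real.rpow_nonneg (truncation_nonneg V (hε N) x) p) (sq_nonneg _)
  have hGle : ∀ N, ∫ x, G N x ≤ C ^ 2 * (K * (N : ℝ)⁻¹) := fun N => by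
    obtain ⟨-, hd, hle⟩ := integral_truncation_le hV hV0 hp (hε N) _
      (hasCompactSupport_averagedBump φ N)
    refine hle.trans ?_
    have h1 := (h _ (hasCompactSupport_averagedBump φ N) hd).2
    calc _ ≤ (C * freeNorm p (averagedBump φ N)) ^ 2 := by gcongr
      _ = C ^ 2 * freeNorm p (averagedBump φ N) ^ 2 := mul_pow _ _ _
      _ ≤ _ := by gcongr; exact hK N
  have hlim : Filter.Tendsto (fun N => ∫⁻ x, ENNReal.ofReal (G N x)) Filter.atTop (nhds 0) := by
    have h1 : Filter.Tendsto (fun N : ℕ => ENNReal.ofReal (C ^ 2 * (K * (N : ℝ)⁻¹)))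
        Filter.atTop (nhds 0) := by
      have := ((tendsto_inv_atTop_nhds_zero_nat (𝕜 := ℝ)).const_mul K).const_mul (C ^ 2)
      rw [mul_zero, mul_zero] at this
      simpa using ENNReal.tendsto_ofReal this
    refine tendsto_of_tendsto_of_tendsto_of_le_of_le tendsto_const_nhds h1 (fun _ => zero_le)
      fun N => ?_
    beta_reduce
    rw [← ofReal_integral_eq_lintegral_ofReal (hGint N) (Filter.Eventually.of_forall (hG0 N))]
    exact ENNReal.ofReal_le_ofReal (hGle N)
  have hpt : ∀ x, Filter.liminf (fun N => ENNReal.ofReal (G N x)) Filter.atTop =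
      ENNReal.ofReal (|V x| ^ p) := fun x => by
    have h1 := ((tendsto_truncation V x).rpow_const (Or.inr hp0.le : |V x| ≠ 0 ∨ 0 ≤ p)).mul
      (tendsto_averagedBump φ x)
    rw [mul_one] at h1
    exact (ENNReal.tendsto_ofReal h1).liminf_eq
  -- Fatou bounds `∫ |V| ^ p` by the limit of `∫ G N`, which is zero.
  have hF := lintegral_liminf_le' (μ := (volume : Measure (Space n))) (u := Filter.atTop)
    (f := fun N x => ENNReal.ofReal (G N x))
    fun N => (hGint N).aestronglyMeasurable.aemeasurable.ennreal_ofReal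
  simp only [hpt] at hF
  have hm : AEMeasurable (fun x => ENNReal.ofReal (|V x| ^ p)) volume :=
    (hV.aestronglyMeasurable.aemeasurable.norm.pow_const p).ennreal_ofReal
  rw [hlim.liminf_eq, nonpos_iff_eq_zero, lintegral_eq_zero_iff' hm] at hF
  filter_upwards [hF] with x hx
  rw [Pi.zero_apply, ENNReal.ofReal_eq_zero] at hx
  have h1 := le_antisymm hx (Real.rpow_nonneg (abs_nonneg _) p)
  rw [Real.rpow_eq_zero (abs_nonneg _) hp0.ne', abs_eq_zero] at h1
  exact h1

end HomSobolev

end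

theorem theorem1 (n : ℕ) (hn : n = 1 ∨ n = 2) (V : HomSobolev.Space n → ℝ)
    (hV_loc : LocallyIntegrable V volume)
    (hV_nonneg : ∀ᵐ x ∂(volume : Measure (HomSobolev.Space n)), 0 ≤ V x)
    (hV_ne : ¬ V =ᵐ[volume] 0)
    (hV_int : Integrable (fun x => V x ^ ((n : ℝ) / 2)) volume) :
    ¬ HomSobolev.HomNormEquiv V ((n : ℝ) / 2) :=
  fun h => hV_ne (HomSobolev.ae_eq_zero_of_homNormEquiv hn hV_loc hV_nonneg h)
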